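/- Work in the max-plus algebra: $R_e=\mathbb{R}\cup\{-\infty\}$, $x\oplus y=\max\{x,y\}$, $x\otimes y=x+y$ (with $-\infty$ absorbing for $\otimes$); products of matrices and vectors, scalar multiples and powers are taken with respect to these operations, so $(Ax)_i=\max_j(a_{ij}+x_j)$ and $\lambda^d x$ is the vector with entries $d\lambda+x_i$. A matrix $A=(a_{ij})\in R_e^{n\times n}$ is called irreducible if for all $i,j$ there are $l\ge 1$ and indices $i=p_0,p_1,\dots,p_l=j$ with $a_{p_0p_1}+a_{p_1p_2}+\dots+a_{p_{l-1}p_l}>-\infty$. **Theorem 2.** Let $A_1,A_2\in R_e^{n\times n}$ be irreducible, and suppose that all main diagonal entries of $A_1$ are different from $-\infty$, or that all main diagonal entries of $A_2$ are different from $-\infty$. Then there exist a real number $\lambda$ and positive integers $d$ and $k_0$ such that every solution $X(0),X(1),X(2),\dots\in R_e^{n}$ of the switched system $$X(k+1)=A_1X(k)\ \ (k\text{ even}),\qquad X(k+1)=A_2X(k)\ \ (k\text{ odd}),$$ with arbitrary initial vector $X(0)\in R_e^n$, satisfies $$X(k+d)=\lambda^{d}X(k)\qquad\text{for all } k\ge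 k_0 .$$ If moreover all entries of $A_1$ and $A_2$ that are different from $-\infty$ are positive, then $\lambda$ can be taken positive (with the same $d$ and $k_0$). -/

import Mathlib

noncomputable section

namespace MaxPlus

/-- The max-plus numbers `ℝ ∪ {-∞}`. The null element `ε = -∞` is `⊥`, the max-plus sum `x ⊕ y`
is the maximum `x ⊔ y`, and the max-plus product `x ⊗ y` is the usual sum `x + y`
(with `⊥ + x = x + ⊥ = ⊥`). -/
abbrev Re : Type := WithBot ℝ

/-- A square matrix is irreducible if for all `i, j` there is a sequence of indices
`i = p 0, p 1, …, p l = j` with `l ≥ 1` and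
`a_{p 0, p 1} + a_{p 1, p 2} + ⋯ + a_{p (l-1), p l} > -∞`. -/
def IsIrreducible {n : ℕ} (A : Matrix (Fin n) (Fin n) Re) : Prop :=
  ∀ i j : Fin n, ∃ (l : ℕ) (p : ℕ → Fin n), 1 ≤ l ∧ p 0 = i ∧ p l = j ∧
    ⊥ < ∑ t ∈ Finset.range l, A (p t) (p (t + 1))

/-- Max-plus matrix-vector product: `(A ⊗ x)_i = ⨁_j a_{ij} ⊗ x_j = max_j (a_{ij} + x_j)`. -/
def mulVec {n : ℕ} (A : Matrix (Fin n) (Fin n) Re) (x : Fin n → Re) : Fin n → Re :=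
  fun i => Finset.univ.sup fun j => A i j + x j

/-- Max-plus scalar multiple of a vector: `(c ⊗ x)_i = c + x_i`. -/
def smul {n : ℕ} (c : Re) (x : Fin n → Re) : Fin n → Re :=
  fun i => c + x i

/-- Max-plus power `c ^ d = c ⊗ ⋯ ⊗ c` (`d` factors). -/
def pow (c : Re) : ℕ → Re
  | 0 => 0
  | d + 1 => pow c d + c

/-- `X` is a solution of the alternating switched system `X (k + 1) = A_i ⊗ X k`, where `i = 1`
for even `k` and `i = 2` for odd `k`. The initial vector `X 0` is arbitrary. -/
def IsSwitchedSolution {n : ℕ} (A₁ A₂ : Matrix (Fin n) (Fin n) Re) (X : ℕ → Fin n → Re) : Prop :=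
  ∀ k : ℕ, X (k + 1) = mulVec (if Even k then A₁ else A₂) (X k)

/-- All entries of the matrix that differ from `-∞` are positive. -/
def FiniteEntriesPos {n : ℕ} (A : Matrix (Fin n) (Fin n) Re) : Prop :=
  ∀ i j : Fin n, A i j ≠ ⊥ → 0 < A i j

end MaxPlus

end

/-! Two steps of the system starting at an even time are one step of `mul A₂ A₁`. If one factor has
a finite diagonal, the finite entries of the other stay finite in the product, so the product is
irreducible and the cyclicity theorem applies to it (`Walk.eventually_periodic`). Odd times follow
on applying `A₁`, which commutes with scalars.

For the cyclicity theorem, read orbits as maximal walk weights and subtract the maximal cycle mean,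
so that no closed walk is positive and some closed walk has weight zero. A walk that cannot be
replaced by one through a critical vertex (one on a zero closed walk) loses weight linearly in its
length, while a detour through a fixed critical vertex loses only a bounded amount. Hence long walks
can be replaced by walks through a critical vertex, and `Walk.through_critical` gives these any
large length in the same residue class. -/

namespace MaxPlus

/-! ### Weighted walks -/

section Walks

variable {V : Type*}

/-- `Walk B k i j w`: there is a walk of length `k` from `i` to `j` in the graph of the entries of
`B` different from `-∞`, of total weight `w`. -/
inductive Walk (B : V → V → Re) : ℕ → V → V → ℝ → Prop
  | nil (i : V) : Walk B 0 i i 0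
  | cons {k : ℕ} {i l j : V} {a w : ℝ} (h : B i l = (a : Re)) (hw : Walk B k l j w) :
      Walk B (k + 1) i j (a + w)

namespace Walk

variable {B : V → V → Re}

theorem cast {k k' : ℕ} {i j : V} {w w' : ℝ} (h : Walk B k i j w) (hk : k = k') (hw : w = w') :
    Walk B k' i j w' := hk ▸ hw ▸ h

theorem zero_iff {i j : V} {w : ℝ} : Walk B 0 i j w ↔ i = j ∧ w = 0 := by
  constructor
  · intro h
    cases h
    exact ⟨rfl, rfl⟩
  · rintro ⟨rfl, rfl⟩
    exact nil i

theorem append {a b : ℕ} {i l j : V} {w₁ w₂ : ℝ} (h₁ : Walk B a i l w₁) (h₂ : Walk B b l j w₂) :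
    Walk B (a + b) i j (w₁ + w₂) := by
  induction h₁ with
  | nil i => exact h₂.cast (by omega) (by ring)
  | cons h _ ih => exact (cons h (ih h₂)).cast (by omega) (by ring)

theorem repeat_closed {m : ℕ} {v : V} {w : ℝ} (h : Walk B m v v w) (q : ℕ) :
    Walk B (q * m) v v (q * w) := by
  induction q with
  | zero => exact (nil v).cast (by simp) (by simp)
  | succ q ih => exact (ih.append h).cast (by ring) (by push_cast; ring)

/-- The vertices `p` and partial weights `S` along a walk. -/
theorem exists_path {k : ℕ} {i j : V} {w : ℝ} (h : Walk B k i j w) :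
    ∃ (p : ℕ → V) (S : ℕ → ℝ), p 0 = i ∧ p k = j ∧ S 0 = 0 ∧ S k = w ∧
      ∀ s t, s + t ≤ k → Walk B t (p s) (p (s + t)) (S (s + t) - S s) := by
  suffices H : ∃ (p : ℕ → V) (S : ℕ → ℝ), p 0 = i ∧ p k = j ∧ S 0 = 0 ∧ S k = w ∧
      ∀ s, s < k → B (p s) (p (s + 1)) = ((S (s + 1) - S s : ℝ) : Re) by
    obtain ⟨p, S, h0, hk, hS0, hSk, hE⟩ := H
    refine ⟨p, S, h0, hk, hS0, hSk, fun s t => ?_⟩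
    induction t generalizing s with
    | zero => intro _; exact (nil (p s)).cast rfl (by simp)
    | succ t ih =>
      intro hst
      have h1 := ih (s + 1) (by omega)
      have h2 := cons (hE s (by omega)) h1
      rw [show s + 1 + t = s + (t + 1) by ring] at h2
      exact h2.cast rfl (by ring)
  induction h with
  | nil i => exact ⟨fun _ => i, fun _ => 0, rfl, rfl, rfl, rfl, fun s hs => by omega⟩
  | @cons k i l j a w h hw ih =>
    obtain ⟨p, S, h0, hk, hS0, hSk, hE⟩ := ih
    refine ⟨fun t => Nat.casesOn t i p, fun t => Nat.casesOn t 0 fun t => a + S t, rfl, hk, rfl,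
      by simp [hSk], ?_⟩
    rintro (_ | s) hs
    · simpa [h0, hS0] using h
    · simpa using hE s (by omega)

theorem shift {k : ℕ} {i j : V} {w : ℝ} (h : Walk B k i j w) (μ : ℝ) :
    Walk (fun i j => B i j + (μ : Re)) k i j (w + k * μ) := by
  induction h with
  | nil i => exact (nil i).cast rfl (by simp)
  | @cons k i l j a w h _ ih =>
    have h' : B i l + (μ : Re) = ((a + μ : ℝ) : Re) := by rw [h, WithBot.coe_add]
    exact (cons (B := fun i j => B i j + (μ : Re)) h' ih).cast rfl (by push_cast; ring)

theorem pos_of_entries_pos (hB : ∀ i j, B i j ≠ ⊥ → 0 < B i j) {k : ℕ} {i j : V} {w : ℝ}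
    (h : Walk B k i j w) : 0 ≤ w ∧ (0 < k → 0 < w) := by
  induction h with
  | nil i => simp
  | @cons k i l j a w h _ ih =>
    have := hB i l (by simp [h])
    rw [h] at this
    have ha : 0 < a := by exact_mod_cast this
    exact ⟨by linarith, fun _ => by linarith⟩

variable [Fintype V]

theorem finite_weights (B : V → V → Re) (k : ℕ) : {w | ∃ i j, Walk B k i j w}.Finite := by
  induction k with
  | zero =>
    refine (Set.finite_singleton (0 : ℝ)).subset ?_
    rintro w ⟨i, j, h⟩
    exact (zero_iff.1 h).2
  | succ k ih =>
    have hE : (Set.range fun x : V × V => (B x.1 x.2).unbotD 0).Finite := Set.finite_range _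
    refine (hE.image2 (· + ·) ih).subset ?_
    rintro w ⟨i, j, h⟩
    cases h with
    | @cons _ _ l _ a w h hw => exact ⟨a, ⟨(i, l), by simp [h]⟩, w, ⟨l, j, hw⟩, rfl⟩

/-- This finiteness supplies the weight gap and the upper and lower bounds in the cyclicity theorem,
and the maximum defining the cycle mean. -/
theorem finite_weights_le (B : V → V → Re) (N : ℕ) :
    {w | ∃ k ≤ N, ∃ i j, Walk B k i j w}.Finite := by
  refine ((Set.finite_Iic N).biUnion fun k _ => finite_weights B k).subset ?_
  rintro w ⟨k, hk, h⟩
  exact Set.mem_biUnion (Set.mem_Iic.2 hk) h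

/-! ### Shortening and padding walks -/

/-- A long walk contains a closed walk of bounded positive length divisible by `c`. -/
theorem exists_closed_subwalk {c : ℕ} (hc : 0 < c) {k : ℕ} {i j : V} {w : ℝ}
    (h : Walk B k i j w) (hk : Fintype.card V * c ≤ k) :
    ∃ (u : V) (a m b : ℕ) (w₁ w₂ w₃ : ℝ), 0 < m ∧ m ≤ Fintype.card V * c ∧ c ∣ m ∧
      a + m + b = k ∧ w₁ + w₂ + w₃ = w ∧
      Walk B a i u w₁ ∧ Walk B m u u w₂ ∧ Walk B b u j w₃ := by
  obtain ⟨p, S, h0, hpk, hS0, hSk, hW⟩ := h.exists_path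
  set N := Fintype.card V * c with hN
  -- Pigeonhole on pairs (vertex, time mod `c`): a repeated pair bounds a closed walk of length
  -- divisible by `c`.
  obtain ⟨x, y, hxy, he⟩ := Fintype.exists_ne_map_eq_of_card_lt
    (fun x : Fin (N + 1) => (p x, (⟨x % c, Nat.mod_lt _ hc⟩ : Fin c))) (by simp [hN])
  wlog hlt : x < y generalizing x y
  · exact this y x hxy.symm he.symm (lt_of_le_of_ne (not_lt.1 hlt) hxy.symm)
  simp only [Prod.mk.injEq, Fin.mk.injEq] at he
  obtain ⟨hp, hm⟩ := he
  have hlt' : (x : ℕ) < y := hlt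
  have hy : (y : ℕ) ≤ N := by omega
  have e1 : (x : ℕ) + (y - x) = y := by omega
  have e2 : (y : ℕ) + (k - y) = k := by omega
  have W1 := hW 0 x (by omega)
  have W2 := hW x (y - x) (by omega)
  have W3 := hW y (k - y) (by omega)
  rw [e1, ← hp] at W2
  rw [e2, ← hp, hpk, hSk] at W3
  rw [zero_add, h0, hS0] at W1
  exact ⟨p x, x, y - x, k - y, _, _, _, by omega, by omega,
    (Nat.modEq_iff_dvd' hlt'.le).1 hm, by omega, by ring, W1, W2, W3⟩

/-- If no closed walk has positive weight, walks can be shortened modulo `c`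
without losing weight. -/
theorem exists_short (hneg : ∀ m u w, Walk B m u u w → w ≤ 0) {c : ℕ} (hc : 0 < c) {k : ℕ}
    {i j : V} {w : ℝ} (h : Walk B k i j w) :
    ∃ k' ≤ Fintype.card V * c, ∃ w', k' ≡ k [MOD c] ∧ w ≤ w' ∧ Walk B k' i j w' := by
  induction k using Nat.strong_induction_on generalizing w with
  | _ k ih =>
    rcases le_total k (Fintype.card V * c) with hk | hk
    · exact ⟨k, hk, w, rfl, le_rfl, h⟩
    · obtain ⟨u, a, m, b, w₁, w₂, w₃, hm, -, hcm, rfl, rfl, W1, W2, W3⟩ :=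
        h.exists_closed_subwalk hc hk
      obtain ⟨k', hk', w', hmod, hw', W'⟩ := ih (a + b) (by omega) (W1.append W3)
      have := hneg _ _ _ W2
      refine ⟨k', hk', w', hmod.trans ?_, by linarith, W'⟩
      have := (Nat.modEq_zero_iff_dvd.2 hcm).symm
      simpa [add_right_comm] using this.add_left (a + b)

/-- Shorten both halves modulo `c`, then make up the missing length, a multiple of `c`, with
zero-weight loops at `v`. -/
theorem through_critical (hneg : ∀ m u w, Walk B m u u w → w ≤ 0) {c : ℕ} (hc : 0 < c)
    {v : V} (hv : Walk B c v v 0) {a b k : ℕ} {i j : V} {w₁ w₂ : ℝ} (h₁ : Walk B a i v w₁)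
    (h₂ : Walk B b v j w₂) (hk : 2 * (Fintype.card V * c) ≤ k) (hmod : a + b ≡ k [MOD c]) :
    ∃ w, w₁ + w₂ ≤ w ∧ Walk B k i j w := by
  obtain ⟨a', ha', w₁', hma, hw₁, W1⟩ := h₁.exists_short hneg hc
  obtain ⟨b', hb', w₂', hmb, hw₂, W2⟩ := h₂.exists_short hneg hc
  have hle : a' + b' ≤ k := by omega
  obtain ⟨q, hq⟩ := (Nat.modEq_iff_dvd' hle).1 ((hma.add hmb).trans hmod)
  refine ⟨w₁' + w₂', by linarith, ((W1.append (hv.repeat_closed q)).append W2).cast ?_ (by ring)⟩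
  rw [mul_comm q c]
  omega

/-! ### Cyclicity -/

/-- The cyclicity theorem for a strongly connected graph of maximal cycle mean zero. -/
theorem eventually_periodic_of_normalized (hneg : ∀ m u w, Walk B m u u w → w ≤ 0)
    (hcrit : ∃ v m, 0 < m ∧ Walk B m v v 0) (hconn : ∀ i j, ∃ k w, Walk B k i j w) :
    ∃ c K : ℕ, 0 < c ∧ ∀ k k', K ≤ k → K ≤ k' → k ≡ k' [MOD c] → ∀ i j w, Walk B k i j w →
      ∃ w', w ≤ w' ∧ Walk B k' i j w' := by
  classical
  -- A product of zero-cycle lengths gives one period for all critical vertices; the others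
  -- contribute the factor 1.
  obtain ⟨c, hc, hcW⟩ : ∃ c, 0 < c ∧ ∀ v, (∃ m, 0 < m ∧ Walk B m v v 0) → Walk B c v v 0 := by
    have : ∀ v, ∃ m, 0 < m ∧ ((∃ m, 0 < m ∧ Walk B m v v 0) → Walk B m v v 0) := by
      intro v
      by_cases h : ∃ m, 0 < m ∧ Walk B m v v 0
      · obtain ⟨m, hm, hW⟩ := h
        exact ⟨m, hm, fun _ => hW⟩
      · exact ⟨1, one_pos, fun h' => absurd h' h⟩
    choose m hm hmW using this
    refine ⟨∏ v, m v, Finset.prod_pos fun v _ => hm v, fun v hv => ?_⟩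
    obtain ⟨q, hq⟩ := Finset.dvd_prod_of_mem m (Finset.mem_univ v)
    exact ((hmW v hv).repeat_closed q).cast (by rw [hq, mul_comm]) (by simp)
  obtain ⟨v, hvc⟩ := hcrit
  have hv := hcW v hvc
  set N := Fintype.card V * c with hN
  have hNpos : 0 < N := Nat.mul_pos (Fintype.card_pos_iff.2 ⟨v⟩) hc
  have hNR : (0 : ℝ) < N := by exact_mod_cast hNpos
  obtain ⟨δ, hδ, hδW⟩ : ∃ δ : ℝ, 0 < δ ∧ ∀ m ≤ N, ∀ u w, Walk B m u u w → w < 0 → w ≤ -δ := by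
    have hfin : ({w | ∃ k ≤ N, ∃ i j, Walk B k i j w} ∩ Set.Iio 0).Finite :=
      (finite_weights_le B N).inter_of_left _
    rcases Set.eq_empty_or_nonempty ({w | ∃ k ≤ N, ∃ i j, Walk B k i j w} ∩ Set.Iio 0) with h | h
    · refine ⟨1, one_pos, fun m hm u w hW hw => ?_⟩
      have : w ∈ ({w | ∃ k ≤ N, ∃ i j, Walk B k i j w} ∩ Set.Iio 0) := ⟨⟨m, hm, u, u, hW⟩, hw⟩
      rw [h] at this
      exact this.elim
    · obtain ⟨x, hx, hmax⟩ := Set.exists_max_image _ id hfin h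
      refine ⟨-x, neg_pos.2 hx.2, fun m hm u w hW hw => ?_⟩
      simpa using hmax w ⟨⟨m, hm, u, u, hW⟩, hw⟩
  obtain ⟨D, hD⟩ := (finite_weights_le B N).bddAbove
  obtain ⟨D', hD'⟩ := (finite_weights_le B N).bddBelow
  -- Remove closed walks of length at most `N`: one of weight zero exhibits a critical vertex, any
  -- other costs at least `δ`. The extra `δ` in the bound covers the base case `k ≤ N`.
  have decay : ∀ k i j w, Walk B k i j w →
      (∃ u a b w₁ w₂, Walk B c u u 0 ∧ a + b ≡ k [MOD c] ∧ w ≤ w₁ + w₂ ∧ Walk B a i u w₁ ∧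
        Walk B b u j w₂) ∨ w ≤ D + δ - δ * (k / N) := by
    intro k i j
    induction k using Nat.strong_induction_on with
    | _ k ih =>
      intro w h
      rcases le_total k N with hk | hk
      · right
        have h1 : w ≤ D := hD ⟨k, hk, i, j, h⟩
        have h2 : (k : ℝ) / N ≤ 1 := by
          rw [div_le_one hNR]
          exact_mod_cast hk
        nlinarith
      · obtain ⟨u, a, m, b, w₁, w₂, w₃, hm, hmN, hcm, rfl, rfl, W1, W2, W3⟩ :=
          h.exists_closed_subwalk hc hk
        have hmod : a + b ≡ a + m + b [MOD c] := by
          have := (Nat.modEq_zero_iff_dvd.2 hcm).symm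
          simpa [add_right_comm] using this.add_left (a + b)
        have h0 := hneg _ _ _ W2
        rcases h0.lt_or_eq with hlt | rfl
        · have hle := hδW m hmN u w₂ W2 hlt
          rcases ih (a + b) (by omega) _ (W1.append W3) with
            ⟨u', a', b', x, y, hu', hmod', hxy, X, Y⟩ | hw
          · exact Or.inl ⟨u', a', b', x, y, hu', hmod'.trans hmod, by linarith, X, Y⟩
          · right
            have h2 : ((a + m + b : ℕ) : ℝ) / N ≤ ((a + b : ℕ) : ℝ) / N + 1 := by
              rw [div_add_one hNR.ne']
              have : (m : ℝ) ≤ N := by exact_mod_cast hmN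
              gcongr
              push_cast
              linarith
            nlinarith
        · exact Or.inl ⟨u, a, b, w₁, w₃, hcW u ⟨m, hm, W2⟩, hmod, by linarith, W1, W3⟩
  have main : ∀ x : V × V, ∃ K : ℕ, ∀ k k', K ≤ k → K ≤ k' → k ≡ k' [MOD c] → ∀ w,
      Walk B k x.1 x.2 w → ∃ w', w ≤ w' ∧ Walk B k' x.1 x.2 w' := by
    rintro ⟨i, j⟩
    obtain ⟨r, f, hf⟩ := hconn j v
    obtain ⟨s, g, hg⟩ := hconn v j
    -- Every residue class of lengths containing a walk contains walks of weight at least `C`.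
    obtain ⟨C, hC⟩ : ∃ C : ℝ, ∀ k k', 2 * N ≤ k' → k ≡ k' [MOD c] → ∀ w, Walk B k i j w →
        ∃ w', C ≤ w' ∧ Walk B k' i j w' := by
      -- A shortened walk weighs at least `D'`; then make the round trip from `j` through `v` `c`
      -- times, which preserves the length modulo `c`.
      refine ⟨D' + c * (f + g), fun k k' hk' hmod w h => ?_⟩
      obtain ⟨l, hl, w', hlk, -, W⟩ := h.exists_short hneg hc
      have hw' : D' ≤ w' := hD' ⟨l, hl, i, j, W⟩
      have L := ((hf.append hg).repeat_closed (c - 1)).append hf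
      obtain ⟨z, hz, Z⟩ := through_critical hneg hc hv (W.append L) hg hk' (by
        refine Nat.ModEq.trans ?_ (hlk.trans hmod)
        have e : l + ((c - 1) * (r + s) + r) + s = l + c * (r + s) := by
          obtain ⟨c', rfl⟩ : ∃ c', c = c' + 1 := ⟨c - 1, by omega⟩
          simp only [Nat.add_sub_cancel]
          ring
        rw [e]
        simp [Nat.ModEq])
      refine ⟨z, ?_, Z⟩
      rw [Nat.cast_sub (by omega : 1 ≤ c)] at hz
      push_cast at hz
      linarith
    -- From this length on, the decay bound is at most `C`.
    obtain ⟨K, hK⟩ := exists_nat_ge ((D + δ - C) * N / δ)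
    refine ⟨max K (2 * N), fun k k' hk hk' hmod w h => ?_⟩
    rcases decay k i j w h with ⟨u, a, b, w₁, w₂, hu, hab, hw, W1, W2⟩ | hw
    · obtain ⟨w', hw', W'⟩ := through_critical hneg hc hu W1 W2 (by omega) (hab.trans hmod)
      exact ⟨w', by linarith, W'⟩
    · obtain ⟨w', hw', W'⟩ := hC k k' (by omega) hmod w h
      refine ⟨w', ?_, W'⟩
      have hkK : (K : ℝ) ≤ k := by exact_mod_cast (le_max_left _ _).trans hk
      have h1 : (D + δ - C) * N / δ ≤ k := hK.trans hkK
      rw [div_le_iff₀ hδ] at h1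
      have h2 : D + δ - C ≤ δ * (k / N) := by
        rw [← mul_div_assoc, le_div_iff₀ hNR]
        linarith
      linarith
  choose K hK using main
  refine ⟨c, Finset.univ.sup K, hc, fun k k' hk hk' hmod i j w h => ?_⟩
  have : K (i, j) ≤ Finset.univ.sup K := Finset.le_sup (Finset.mem_univ _)
  exact hK (i, j) k k' (this.trans hk) (this.trans hk') hmod w h

/-! ### Maximal cycle mean and normalization -/

/-- The maximal cycle mean. -/
theorem exists_max_cycle_mean (hcyc : ∃ m v w, 0 < m ∧ Walk B m v v w) :
    ∃ μ : ℝ, (∃ v m, 0 < m ∧ Walk B m v v (m * μ)) ∧ ∀ m u w, Walk B m u u w → w ≤ m * μ := by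
  set n := Fintype.card V with hn
  -- Closed walks of length at most `n` suffice: a longer one splits into two shorter closed walks,
  -- and the bound is additive.
  let P : Set ℝ := {x | ∃ m u w, 0 < m ∧ m ≤ n ∧ Walk B m u u w ∧ x = w / m}
  have hfin : P.Finite := by
    refine ((finite_weights_le B n).image2 (fun w (m : ℕ) => w / (m : ℝ))
      (Set.finite_Iic n)).subset ?_
    rintro x ⟨m, u, w, hm, hmn, hW, rfl⟩
    exact ⟨w, ⟨m, hmn, u, u, hW⟩, m, hmn, rfl⟩
  have hne : P.Nonempty := by
    obtain ⟨m, v, w, hm, hW⟩ := hcyc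
    rcases le_total m n with h | h
    · exact ⟨_, m, v, w, hm, h, hW, rfl⟩
    · obtain ⟨u, a, m, b, w₁, w₂, w₃, hm, hmn, -, -, -, -, W2, -⟩ :=
        hW.exists_closed_subwalk one_pos (by simpa using h)
      exact ⟨_, m, u, w₂, hm, by simpa using hmn, W2, rfl⟩
  obtain ⟨μ, ⟨m, v, w, hm, -, hW, hμ⟩, hmax⟩ := Set.exists_max_image P id hfin hne
  have hshort : ∀ m u w, m ≤ n → Walk B m u u w → w ≤ m * μ := by
    intro m u w hmn hW
    rcases Nat.eq_zero_or_pos m with rfl | hm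
    · simp [(zero_iff.1 hW).2]
    · have := hmax _ ⟨m, u, w, hm, hmn, hW, rfl⟩
      have hmR : (0 : ℝ) < m := by exact_mod_cast hm
      simp only [id] at this
      rw [div_le_iff₀ hmR] at this
      linarith
  refine ⟨μ, ⟨v, m, hm, hW.cast rfl ?_⟩, ?_⟩
  · have hmR : (m : ℝ) ≠ 0 := by exact_mod_cast hm.ne'
    rw [hμ]
    field_simp
  · intro k
    induction k using Nat.strong_induction_on with
    | _ k ih =>
      intro u w h
      rcases le_total k n with hk | hk
      · exact hshort k u w hk h
      · obtain ⟨z, a, m, b, w₁, w₂, w₃, hm, hmn, -, rfl, rfl, W1, W2, W3⟩ :=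
          h.exists_closed_subwalk one_pos (by simpa using hk)
        have h1 := hshort m z w₂ (by simpa using hmn) W2
        have h2 := ih (a + b) (by omega) u _ (W1.append W3)
        push_cast at h2 ⊢
        linarith

/-- The cyclicity theorem for strongly connected weighted graphs. -/
theorem eventually_periodic [Nonempty V] (hconn : ∀ i j, ∃ k w, 0 < k ∧ Walk B k i j w) :
    ∃ (μ : ℝ) (c K : ℕ), 0 < c ∧ (∃ v m, 0 < m ∧ Walk B m v v (m * μ)) ∧
      ∀ k k', K ≤ k → K ≤ k' → k ≡ k' [MOD c] → ∀ i j w, Walk B k i j w →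
        ∃ w', w - k * μ ≤ w' - k' * μ ∧ Walk B k' i j w' := by
  obtain ⟨μ, hcrit, hle⟩ := exists_max_cycle_mean (B := B) (by
    obtain ⟨v⟩ := ‹Nonempty V›
    obtain ⟨k, w, hk, hW⟩ := hconn v v
    exact ⟨k, v, w, hk, hW⟩)
  set B' : V → V → Re := fun i j => B i j + ((-μ : ℝ) : Re) with hB'
  have back : ∀ {k i j w}, Walk B' k i j w → Walk B k i j (w + k * μ) := by
    intro k i j w h
    have := h.shift μ
    have e : (fun i j => B' i j + (μ : Re)) = B := by
      funext i j
      simp only [hB', add_assoc, ← WithBot.coe_add]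
      simp
    rwa [e] at this
  obtain ⟨c, K, hc, H⟩ := eventually_periodic_of_normalized (B := B')
    (fun m u w h => by linarith [hle m u _ (back h)])
    (by
      obtain ⟨v, m, hm, hW⟩ := hcrit
      exact ⟨v, m, hm, (hW.shift (-μ)).cast rfl (by ring)⟩)
    (fun i j => by
      obtain ⟨k, w, -, hW⟩ := hconn i j
      exact ⟨k, _, hW.shift (-μ)⟩)
  refine ⟨μ, c, K, hc, hcrit, fun k k' hk hk' hmod i j w h => ?_⟩
  obtain ⟨w', hw', W'⟩ := H k k' hk hk' hmod i j _ (h.shift (-μ))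
  exact ⟨w' + k' * μ, by linarith, back W'⟩

end Walk

end Walks

/-! ### Max-plus matrices and orbits -/

variable {n : ℕ}

theorem le_mulVec (A : Matrix (Fin n) (Fin n) Re) (x : Fin n → Re) (i j : Fin n) :
    A i j + x j ≤ mulVec A x i :=
  Finset.le_sup (f := fun j => A i j + x j) (Finset.mem_univ j)

theorem exists_mulVec_eq [NeZero n] (A : Matrix (Fin n) (Fin n) Re) (x : Fin n → Re) (i : Fin n) :
    ∃ j, mulVec A x i = A i j + x j := by
  obtain ⟨j, -, hj⟩ := Finset.exists_mem_eq_sup Finset.univ ⟨0, Finset.mem_univ _⟩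
    fun j => A i j + x j
  exact ⟨j, hj⟩

/-- The max-plus matrix product. -/
def mul (A B : Matrix (Fin n) (Fin n) Re) : Matrix (Fin n) (Fin n) Re :=
  fun i j => Finset.univ.sup fun l => A i l + B l j

theorem le_mul (A B : Matrix (Fin n) (Fin n) Re) (i l j : Fin n) :
    A i l + B l j ≤ mul A B i j :=
  le_mulVec A (fun l => B l j) i l

theorem exists_mul_eq [NeZero n] (A B : Matrix (Fin n) (Fin n) Re) (i j : Fin n) :
    ∃ l, mul A B i j = A i l + B l j :=
  exists_mulVec_eq A (fun l => B l j) i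

theorem mulVec_mulVec [NeZero n] (A B : Matrix (Fin n) (Fin n) Re) (x : Fin n → Re) :
    mulVec A (mulVec B x) = mulVec (mul A B) x := by
  funext i
  apply le_antisymm
  · obtain ⟨l, hl⟩ := exists_mulVec_eq A (mulVec B x) i
    obtain ⟨j, hj⟩ := exists_mulVec_eq B x l
    rw [hl, hj, ← add_assoc]
    exact (add_le_add_left (le_mul A B i l j) _).trans (le_mulVec _ x i j)
  · obtain ⟨j, hj⟩ := exists_mulVec_eq (mul A B) x i
    obtain ⟨l, hl⟩ := exists_mul_eq A B i j
    rw [hj, hl, add_assoc]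
    exact (add_le_add_right (le_mulVec B x l j) _).trans (le_mulVec A _ i l)

theorem mulVec_smul [NeZero n] (A : Matrix (Fin n) (Fin n) Re) (c : Re) (x : Fin n → Re) :
    mulVec A (smul c x) = smul c (mulVec A x) := by
  funext i
  apply le_antisymm
  · obtain ⟨j, hj⟩ := exists_mulVec_eq A (smul c x) i
    rw [hj]
    simp only [smul]
    rw [add_left_comm]
    exact add_le_add_right (le_mulVec A x i j) _
  · obtain ⟨j, hj⟩ := exists_mulVec_eq A x i
    simp only [smul]
    rw [hj, add_left_comm]
    exact le_mulVec A (smul c x) i j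

theorem pow_coe (c : ℝ) (d : ℕ) : pow (c : Re) d = ((d * c : ℝ) : Re) := by
  induction d with
  | zero => simp [pow]
  | succ d ih =>
    rw [pow, ih, ← WithBot.coe_add, Nat.cast_succ, add_one_mul]

theorem Walk.add_le {B : Matrix (Fin n) (Fin n) Re} {Y : ℕ → Fin n → Re}
    (hY : ∀ m, Y (m + 1) = mulVec B (Y m)) {k : ℕ} {i j : Fin n} {w : ℝ} (h : Walk B k i j w) :
    (w : Re) + Y 0 j ≤ Y k i := by
  induction h with
  | nil i => simp
  | @cons k i l j a w h _ ih =>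
    rw [hY, WithBot.coe_add, add_assoc, ← h]
    exact (add_le_add_right ih _).trans (le_mulVec B _ i l)

theorem exists_walk_eq [NeZero n] {B : Matrix (Fin n) (Fin n) Re} {Y : ℕ → Fin n → Re}
    (hY : ∀ m, Y (m + 1) = mulVec B (Y m)) (k : ℕ) (i : Fin n) :
    Y k i = ⊥ ∨ ∃ j w, Walk B k i j w ∧ Y k i = (w : Re) + Y 0 j := by
  induction k generalizing i with
  | zero => exact Or.inr ⟨i, 0, Walk.nil i, by simp⟩
  | succ k ih =>
    obtain ⟨l, hl⟩ := exists_mulVec_eq B (Y k) i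
    rw [hY, hl]
    rcases ih l with h | ⟨j, w, hW, h⟩
    · left
      rw [h, WithBot.add_bot]
    · rcases eq_or_ne (B i l) ⊥ with hB | hB
      · exact Or.inl (by rw [hB, WithBot.bot_add])
      · obtain ⟨a, ha⟩ := WithBot.ne_bot_iff_exists.1 hB
        exact Or.inr ⟨j, a + w, Walk.cons ha.symm hW, by rw [h, ← ha, WithBot.coe_add, add_assoc]⟩

/-- The one-sided comparison `H`, used from `k + c` to `k` and back, gives the two inequalities. -/
theorem orbit_periodic [NeZero n] {B : Matrix (Fin n) (Fin n) Re} {μ : ℝ} {c K : ℕ}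
    (H : ∀ k k', K ≤ k → K ≤ k' → k ≡ k' [MOD c] → ∀ i j w, Walk B k i j w →
      ∃ w', w - k * μ ≤ w' - k' * μ ∧ Walk B k' i j w')
    {Y : ℕ → Fin n → Re} (hY : ∀ m, Y (m + 1) = mulVec B (Y m)) {k : ℕ} (hk : K ≤ k) :
    Y (k + c) = smul ((c * μ : ℝ) : Re) (Y k) := by
  have hmod : k ≡ k + c [MOD c] := by simp [Nat.ModEq]
  funext i
  simp only [smul]
  apply le_antisymm
  · rcases exists_walk_eq hY (k + c) i with h | ⟨j, w, hW, h⟩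
    · rw [h]
      exact bot_le
    · obtain ⟨w', hw', W'⟩ := H (k + c) k (by omega) hk hmod.symm i j w hW
      push_cast at hw'
      rw [h]
      refine le_trans ?_ (add_le_add_right (W'.add_le hY) _)
      rw [← add_assoc, ← WithBot.coe_add]
      exact add_le_add_left (WithBot.coe_le_coe.2 (by linarith)) _
  · rcases exists_walk_eq hY k i with h | ⟨j, w, hW, h⟩
    · rw [h, WithBot.add_bot]
      exact bot_le
    · obtain ⟨w', hw', W'⟩ := H k (k + c) hk (by omega) hmod i j w hW
      push_cast at hw'
      rw [h]
      refine le_trans ?_ (W'.add_le hY)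
      rw [← add_assoc, ← WithBot.coe_add]
      exact add_le_add_left (WithBot.coe_le_coe.2 (by linarith)) _

theorem exists_walk_of_isIrreducible {A B : Matrix (Fin n) (Fin n) Re} (hA : IsIrreducible A)
    (hAB : ∀ i j, A i j ≠ ⊥ → B i j ≠ ⊥) (i j : Fin n) : ∃ k w, 0 < k ∧ Walk B k i j w := by
  obtain ⟨l, p, hl, rfl, rfl, hp⟩ := hA i j
  have hedge : ∀ t < l, B (p t) (p (t + 1)) ≠ ⊥ := by
    intro t ht
    apply hAB
    intro h
    apply hp.ne'
    exact WithBot.sum_eq_bot_iff.2 ⟨t, Finset.mem_range.2 ht, h⟩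
  suffices ∀ t ≤ l, ∃ w, Walk B t (p 0) (p t) w by
    obtain ⟨w, hW⟩ := this l le_rfl
    exact ⟨l, w, hl, hW⟩
  intro t
  induction t with
  | zero => exact fun _ => ⟨0, Walk.nil _⟩
  | succ t ih =>
    intro ht
    obtain ⟨w, hW⟩ := ih (by omega)
    obtain ⟨a, ha⟩ := WithBot.ne_bot_iff_exists.1 (hedge t (by omega))
    exact ⟨_, hW.append (Walk.cons ha.symm (Walk.nil _))⟩

theorem mul_ne_bot {A B : Matrix (Fin n) (Fin n) Re} {i l j : Fin n} (hA : A i l ≠ ⊥)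
    (hB : B l j ≠ ⊥) : mul A B i j ≠ ⊥ := by
  intro h
  have := le_mul A B i l j
  rw [h, le_bot_iff, WithBot.add_eq_bot] at this
  exact this.elim hA hB

theorem FiniteEntriesPos.mul [NeZero n] {A B : Matrix (Fin n) (Fin n) Re}
    (hA : FiniteEntriesPos A) (hB : FiniteEntriesPos B) : FiniteEntriesPos (mul A B) := by
  intro i j h
  obtain ⟨l, hl⟩ := exists_mul_eq A B i j
  rw [hl] at h ⊢
  rw [Ne, WithBot.add_eq_bot, not_or] at h
  have hA' := hA i l h.1
  have hB' := hB l j h.2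
  obtain ⟨a, ha⟩ := WithBot.ne_bot_iff_exists.1 h.1
  obtain ⟨b, hb⟩ := WithBot.ne_bot_iff_exists.1 h.2
  rw [← ha] at hA' ⊢
  rw [← hb] at hB' ⊢
  rw [← WithBot.coe_add]
  exact WithBot.coe_pos.2 (add_pos (WithBot.coe_pos.1 hA') (WithBot.coe_pos.1 hB'))

end MaxPlus

/-! ### The switched system -/

theorem theorem2 (n : ℕ) (A₁ A₂ : Matrix (Fin n) (Fin n) MaxPlus.Re)
    (h₁ : MaxPlus.IsIrreducible A₁) (h₂ : MaxPlus.IsIrreducible A₂)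
    (hdiag : (∀ i, A₁ i i ≠ ⊥) ∨ (∀ i, A₂ i i ≠ ⊥)) :
    ∃ (lam : ℝ) (d k₀ : ℕ), 0 < d ∧ 0 < k₀ ∧
      (MaxPlus.FiniteEntriesPos A₁ → MaxPlus.FiniteEntriesPos A₂ → 0 < lam) ∧
      ∀ X : ℕ → Fin n → MaxPlus.Re, MaxPlus.IsSwitchedSolution A₁ A₂ X →
        ∀ k : ℕ, k₀ ≤ k →
          X (k + d) = MaxPlus.smul (MaxPlus.pow (lam : MaxPlus.Re) d) (X k) := by
  rcases Nat.eq_zero_or_pos n with rfl | hn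
  · exact ⟨1, 1, 1, one_pos, one_pos, fun _ _ => one_pos, fun X _ k _ => funext fun i => i.elim0⟩
  have : NeZero n := ⟨hn.ne'⟩
  have hconn : ∀ i j, ∃ k w, 0 < k ∧ MaxPlus.Walk (MaxPlus.mul A₂ A₁) k i j w := by
    rcases hdiag with h | h
    · exact MaxPlus.exists_walk_of_isIrreducible h₂ fun i j hij => MaxPlus.mul_ne_bot hij (h j)
    · exact MaxPlus.exists_walk_of_isIrreducible h₁ fun i j hij => MaxPlus.mul_ne_bot (h i) hij
  obtain ⟨μ, c, K, hc, ⟨v, m, hm, hW⟩, H⟩ := MaxPlus.Walk.eventually_periodic hconn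
  -- One step of the product is two steps of the system, hence `μ / 2` and `2 * c`; the `+ 1` only
  -- makes `k₀` positive.
  refine ⟨μ / 2, 2 * c, 2 * K + 1, by omega, by omega, fun p₁ p₂ => ?_, fun X hX k hk => ?_⟩
  · have h := (hW.pos_of_entries_pos (p₂.mul p₁)).2 hm
    have hmR : (0 : ℝ) < m := by exact_mod_cast hm
    exact half_pos (pos_of_mul_pos_right h hmR.le)
  · have hY : ∀ t, X (2 * (t + 1)) = MaxPlus.mulVec (MaxPlus.mul A₂ A₁) (X (2 * t)) := by
      intro t
      rw [← MaxPlus.mulVec_mulVec, show 2 * (t + 1) = 2 * t + 1 + 1 by ring,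
        hX (2 * t + 1), hX (2 * t), if_pos (even_two_mul t), if_neg (by simp [parity_simps])]
    have hpow : MaxPlus.pow ((μ / 2 : ℝ) : MaxPlus.Re) (2 * c) = ((c * μ : ℝ) : MaxPlus.Re) := by
      rw [MaxPlus.pow_coe, show ((2 * c : ℕ) : ℝ) * (μ / 2) = c * μ by push_cast; ring]
    have heven : ∀ t, K ≤ t →
        X (2 * t + 2 * c) = MaxPlus.smul ((c * μ : ℝ) : MaxPlus.Re) (X (2 * t)) := by
      intro t ht
      rw [← mul_add]
      exact MaxPlus.orbit_periodic H (Y := fun t => X (2 * t)) hY ht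
    rw [hpow]
    rcases Nat.even_or_odd' k with ⟨t, rfl | rfl⟩
    · exact heven t (by omega)
    · rw [show 2 * t + 1 + 2 * c = 2 * t + 2 * c + 1 by ring, hX (2 * t + 2 * c), hX (2 * t),
        if_pos (even_two_mul t), if_pos (by simp [parity_simps]), heven t (by omega),
        MaxPlus.mulVec_smul]
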